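/- **Machines.** A one-way nondeterministic Turing machine (NTM) is a tuple $M=(Q,\Sigma,\Gamma,\delta,q_0,F)$ with finite sets $Q$ (states), $\Sigma$ (input alphabet) and $\Gamma$ (worktape alphabet, containing a blank symbol $\sqcup$), an initial state $q_0\in Q$, a set $F\subseteq Q$ of final states, and a finite set of transitions $$\delta\subseteq Q\times(\Sigma\cup\{\lambda,\triangleleft\})\times\Gamma\times Q\times\Gamma\times\{\mathrm L,\mathrm S,\mathrm R\}.$$ A transition $(q,a,c,q',d,m)$ can be used in state $q$ when the worktape head scans $c$ and the remaining input begins with $a$ (no condition on the input if $a=\lambda$); it consumes $a$, enters state $q'$, overwrites $c$ by $d$ and moves the worktape head one cell to the left ($\mathrm L$), not at all ($\mathrm S$), or one cell to the right ($\mathrm R$). The worktape is infinite in both directions. A computation on $w\in\Sigma^*$ is a finite sequence of steps that begins in state $q_0$ with input $w\triangleleft$ (where $\triangleleft$ is an end-marker) and a blank worktape. It is accepting if it ends in a state of $F$ with all of $w\triangleleft$ consumed. $L(M)$ is the set of all $w$ on which $M$ has an accepting computation. **Turns, crossings, visits.** Let $i_0,i_1,\dots,i_n\in\mathbb Z$ be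 the successive positions of the worktape head in an accepting computation, with $i_0=1$. The computation makes a turn at $j\ge 1$ if there is an index $0\le l\le j-1$ with $i_l\ne i_{j-1}$ and, for the largest such $l$, either $i_j<i_{j-1}$ and $i_l<i_{j-1}$, or $i_j>i_{j-1}$ and $i_l>i_{j-1}$. The computation is * *$k$-turn* if it makes at most $k$ turns; * *$k$-crossing* if for every $r\in\mathbb Z$ there are at most $k$ indices $0\le j<n$ with $\{i_j,i_{j+1}\}=\{r,r+1\}$; * *$k$-visit* if for every $r\in\mathbb Z$ there are at most $k$ indices $0\le j\le n$ with $i_j=r$. **Proposition.** Each of the following problems is undecidable: given (a standard finite description of) an NTM $M$ and an integer $k\ge 0$, decide whether there is an input $x\in L(M)$ such that 1. all accepting computations of $M$ on $x$ are $k$-turn; 2. all accepting computations of $M$ on $x$ are $k$-crossing; 3. all accepting computations of $M$ on $x$ are $k$-visit (here with $k\ge 1$). Moreover, each problem is undecidable already for every fixed value of $k$ ($k\ge 0$ in 1 and 2, $k\ge 1$ in 3), with only $M$ given. -/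

import Mathlib

/-- The possible moves of the worktape head: left, stay, right. -/
inductive HeadMove : Type
  | L
  | S
  | R

namespace HeadMove

/-- The change of the worktape address caused by a move. -/
def delta : HeadMove → ℤ
  | L => -1
  | S => 0
  | R => 1

/-- The number under which a move is written in a machine description. -/
def toNat : HeadMove → ℕ
  | L => 0
  | S => 1
  | R => 2

/-- The effect of a move on a two-way infinite tape. -/
def onTape {Γ : Type} [Inhabited Γ] : HeadMove → Turing.Tape Γ → Turing.Tape Γ
  | L, T => T.move Turing.Dir.left
  | S, T => T
  | R, T => T.move Turing.Dir.right

end HeadMove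

/-- What a transition reads from the input: `none` is the empty word, `some none` is the right
end-marker, and `some (some a)` is the letter `a`. -/
abbrev InputLabel (A : Type) : Type := Option (Option A)

/-- A transition `(q, a, c, q', d, m)`: in state `q`, reading `a` from the input and scanning `c`
on the worktape, go to state `q'`, replace `c` by `d` and move the worktape head by `m`. -/
abbrev NTMTransition (Q A Γ : Type) : Type :=
  Q × InputLabel A × Γ × Q × Γ × HeadMove

/-- A one-way nondeterministic Turing machine with state set `Q`, input alphabet `A` and worktape
alphabet `Γ`, whose blank symbol is `default`. The machines considered are those with `Q`, `A`
and `Γ` finite, so that the transition relation is finite too. -/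
structure NTM (Q A Γ : Type) where
  trans : Set (NTMTransition Q A Γ)
  start : Q
  final : Set Q

/-- A configuration: the state, the remaining input (in which `none` is the right end-marker),
the worktape with the position of its head, and the worktape address, which is the absolute
position of the head (it is `1` at the start of a computation). -/
structure NTMConfig (Q A Γ : Type) [Inhabited Γ] where
  state : Q
  input : List (Option A)
  tape : Turing.Tape Γ
  addr : ℤ

namespace NTM

variable {Q A Γ : Type} [Inhabited Γ]

/-- The initial configuration on the word `w`: the input is `w` followed by the end-marker and
the worktape is blank. -/
def initial (M : NTM Q A Γ) (w : List A) : NTMConfig Q A Γ where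
  state := M.start
  input := w.map some ++ [none]
  tape := Turing.Tape.mk₁ []
  addr := 1

/-- The one-step relation of the machine. -/
def Step (M : NTM Q A Γ) (c c' : NTMConfig Q A Γ) : Prop :=
  ∃ (a : InputLabel A) (d : Γ) (m : HeadMove),
    (c.state, a, c.tape.head, c'.state, d, m) ∈ M.trans ∧
    c.input = a.toList ++ c'.input ∧
    c'.tape = m.onTape (c.tape.write d) ∧
    c'.addr = c.addr + m.delta

/-- `c 0 ⊢ c 1 ⊢ ⋯ ⊢ c n` is an accepting computation on the word `w`. -/
structure IsAcceptingComputation (M : NTM Q A Γ) (w : List A) (n : ℕ)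
    (c : ℕ → NTMConfig Q A Γ) : Prop where
  init : c 0 = M.initial w
  step : ∀ j < n, M.Step (c j) (c (j + 1))
  state_mem : (c n).state ∈ M.final
  input_eq : (c n).input = []

/-- The language accepted by the machine. -/
def language (M : NTM Q A Γ) : Set (List A) :=
  {w | ∃ n c, M.IsAcceptingComputation w n c}

end NTM

/-- A head whose successive addresses are `i 0, i 1, …` makes a turn in step `j ≥ 1`: it moves at
step `j`, and its last earlier move was in the opposite direction. Here `l` is the last index
before `j` at which the head was elsewhere than at time `j - 1`. -/
def MakesTurn (i : ℕ → ℤ) (j : ℕ) : Prop :=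
  1 ≤ j ∧ ∃ l, IsGreatest {l | l ≤ j - 1 ∧ i l ≠ i (j - 1)} l ∧
    ((i j < i (j - 1) ∧ i l < i (j - 1)) ∨ (i (j - 1) < i j ∧ i (j - 1) < i l))

/-- The address sequence `i 0, …, i n` makes at most `k` turns. -/
def IsKTurn (k : ℕ) (n : ℕ) (i : ℕ → ℤ) : Prop :=
  {j | j ≤ n ∧ MakesTurn i j}.ncard ≤ k

/-- The address sequence `i 0, …, i n` crosses each boundary between two adjacent cells `r` and
`r + 1` at most `k` times. -/
def IsKCrossing (k : ℕ) (n : ℕ) (i : ℕ → ℤ) : Prop :=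
  ∀ r : ℤ, {j | j < n ∧ ((i j = r ∧ i (j + 1) = r + 1) ∨
    (i j = r + 1 ∧ i (j + 1) = r))}.ncard ≤ k

/-- The address sequence `i 0, …, i n` visits each cell at most `k` times. -/
def IsKVisit (k : ℕ) (n : ℕ) (i : ℕ → ℤ) : Prop :=
  ∀ r : ℤ, {j | j ≤ n ∧ i j = r}.ncard ≤ k

/-- There is a word in the language of `M` all of whose accepting computations have an address
sequence with the property `P`. -/
def NTM.ExistsInputAllAccepting {Q A Γ : Type} [Inhabited Γ] (M : NTM Q A Γ)
    (P : ℕ → (ℕ → ℤ) → Prop) : Prop :=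
  ∃ x ∈ M.language, ∀ n c, M.IsAcceptingComputation x n c → P n (fun j => (c j).addr)

/-- Finite descriptions `(s, a, g, δ, q₀, F)` of machines. The described machine has the states
`0, …, s`, the input letters `0, …, a - 1`, the worktape symbols `0, …, g` with blank `0`, the
list `δ` of transitions, the initial state `q₀` and the list `F` of final states.
Up to renaming of states and symbols, every machine has a description. -/
abbrev NTMDescription : Type :=
  ℕ × ℕ × ℕ × List (ℕ × Option (Option ℕ) × ℕ × ℕ × ℕ × ℕ) × ℕ × List ℕ

namespace NTMDescription

abbrev State (D : NTMDescription) : Type := Fin (D.1 + 1)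

abbrev Letter (D : NTMDescription) : Type := Fin D.2.1

abbrev Symbol (D : NTMDescription) : Type := Fin (D.2.2.1 + 1)

/-- The way in which a transition is written in a description. -/
def writeTransition (D : NTMDescription) (t : NTMTransition D.State D.Letter D.Symbol) :
    ℕ × Option (Option ℕ) × ℕ × ℕ × ℕ × ℕ :=
  match t with
  | (q, a, c, q', d, m) =>
    ((q : ℕ), a.map (Option.map (fun b : D.Letter => (b : ℕ))), (c : ℕ), (q' : ℕ), (d : ℕ),
      m.toNat)

/-- The described machine. List entries that mention numbers out of range are ignored, and the
initial state is read modulo the number of states. -/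
def machine (D : NTMDescription) : NTM D.State D.Letter D.Symbol where
  trans := {t | D.writeTransition t ∈ D.2.2.2.1}
  start := Fin.ofNat (D.1 + 1) D.2.2.2.2.1
  final := {q | (q : ℕ) ∈ D.2.2.2.2.2}

end NTMDescription

/-! Halting is reduced to the negation of each question. Let `T` be a Turing machine whose halting
on tapes `x y z ⋯ z` with `m` letters `z` is undecidable in `m`. For each `m`, a machine is built
that accepts only the empty word and can always do so in one step, consuming the end-marker. It may
instead write `x y z ⋯ z`, simulate `T` and, once `T` has halted, swing its head between two
adjacent cells as often as it likes before accepting. If `T` never halts, every accepting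
computation is a single step and meets the bound (`accepting_of_not_halts`). If `T` halts, some
accepting computation exceeds it (`exists_accepting_of_halts`).

`T` is compiled from a universal program reading `m` off the input `2 ^ m`. Powers of two give tapes
so uniform that `m` enters the description only through the states that write the tape.

State numbers: `0` accepts, `1` and `2` swing, `3 + q` simulates `q`, and `N + 4`, `N + 5`, `N + 6 +
i` write `x`, `y` and the letters `z`. -/

open Turing

/-! ### Undecidable halting on uniform tapes -/

theorem PartrecToTM2.trNat_two_pow (m : ℕ) :
    PartrecToTM2.trNat (2 ^ m) =
      List.replicate m PartrecToTM2.Γ'.bit0 ++ [PartrecToTM2.Γ'.bit1] := by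
  have key : ∀ m, ∃ p : PosNum, ((2 ^ m : ℕ) : Num) = Num.pos p ∧ PartrecToTM2.trPosNum p =
      List.replicate m PartrecToTM2.Γ'.bit0 ++ [PartrecToTM2.Γ'.bit1] := by
    intro m
    induction m with
    | zero => exact ⟨PosNum.one, by simp; rfl, rfl⟩
    | succ m ih =>
      obtain ⟨p, hp, h⟩ := ih
      refine ⟨PosNum.bit0 p, ?_, by simp [PartrecToTM2.trPosNum, h, List.replicate_succ]⟩
      rw [pow_succ, mul_two, Nat.cast_add, hp, Num.bit0_of_bit0]
      rfl
  obtain ⟨p, hp, h⟩ := key m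
  rw [PartrecToTM2.trNat, hp, ← h]
  rfl

/-- The discrete logarithm decodes `m` from `2 ^ m`; as a bounded search it is primitive recursive.
-/
theorem Computable.findGreatest_two_pow :
    Computable fun n : ℕ => Nat.findGreatest (fun m => 2 ^ m ≤ n) n := by
  have hpow : Primrec fun m : ℕ => 2 ^ m := by
    refine (Primrec.nat_rec₁ 1 (Primrec.nat_mul.comp Primrec.snd (Primrec.const 2)).to₂).of_eq ?_
    intro m
    induction m with
    | zero => rfl
    | succ m ih => simp only [pow_succ, ← ih]
  have hle : PrimrecRel fun n m : ℕ => 2 ^ m ≤ n :=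
    Primrec.nat_le.comp (hpow.comp Primrec.snd) Primrec.fst
  exact (Primrec.nat_findGreatest Primrec.id hle).to_comp

theorem Nat.findGreatest_two_pow (m : ℕ) [DecidablePred fun i => 2 ^ i ≤ 2 ^ m] :
    Nat.findGreatest (fun i => 2 ^ i ≤ 2 ^ m) (2 ^ m) = m := by
  rw [Nat.findGreatest_eq_iff]
  refine ⟨Nat.lt_two_pow_self.le, fun _ => le_rfl, fun i hi _ => ?_⟩
  exact not_le.2 (Nat.pow_lt_pow_right one_lt_two hi)

/-- The halting problem of a fixed program, restricted to the inputs `2 ^ m`. -/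
theorem exists_toPartrec_code_not_computablePred :
    ∃ c : ToPartrec.Code, ¬ ComputablePred fun m : ℕ => (c.eval [2 ^ m]).Dom := by
  let f : ℕ →. ℕ := fun m => (Denumerable.ofNat Nat.Partrec.Code m).eval 0
  have hf : Partrec f := Nat.Partrec.Code.eval_part.comp (Computable.ofNat _) (Computable.const 0)
  have hg : Nat.Partrec' fun v : List.Vector ℕ 1 =>
      f (Nat.findGreatest (fun i => 2 ^ i ≤ v.head) v.head) :=
    Nat.Partrec'.of_part
      (hf.comp (Computable.findGreatest_two_pow.comp Primrec.vector_head.to_comp))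
  obtain ⟨c, hc⟩ := ToPartrec.Code.exists_code hg
  refine ⟨c, fun h => ComputablePred.halting_problem 0 ?_⟩
  have hdom : ∀ m, (c.eval [2 ^ m]).Dom ↔ (f m).Dom := by
    intro m
    have := hc ⟨[2 ^ m], rfl⟩
    change c.eval [2 ^ m] = _ at this
    rw [this]
    exact iff_of_eq (congrArg (fun i => (f i).Dom) (Nat.findGreatest_two_pow m))
  -- Since `f` runs the code numbered `m` on input `0`, encoding a code reduces the halting problem
  -- to the domain of `f`.
  refine ComputablePred.computable_of_manyOneReducible
    ⟨fun c => Encodable.encode c, Computable.encode, fun c => ?_⟩ h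
  rw [hdom]
  simp [f]

/-- A finite set containing the default element can be numbered so that this element gets `0`. -/
theorem Set.Finite.exists_fin_numbering {α : Type} [Inhabited α] {A : Set α} (hA : A.Finite)
    (hd : default ∈ A) : ∃ (n : ℕ) (i : α → Fin (n + 1)) (j : Fin (n + 1) → α),
      i default = default ∧ j default = default ∧ ∀ a ∈ A, j (i a) = a := by
  classical
  have := hA.fintype
  obtain ⟨n, hn⟩ : ∃ n, Fintype.card A = n + 1 :=
    Nat.exists_eq_succ_of_ne_zero (Fintype.card_pos_iff.2 ⟨⟨_, hd⟩⟩).ne'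
  let e₀ : A ≃ Fin (n + 1) := Fintype.equivFinOfCardEq hn
  let e := e₀.trans (Equiv.swap (e₀ ⟨default, hd⟩) default)
  have he : e ⟨default, hd⟩ = default := by simp [e]
  refine ⟨n, fun a => if h : a ∈ A then e ⟨a, h⟩ else default, fun k => (e.symm k : α), ?_, ?_, ?_⟩
  · simp [hd, he]
  · rw [← he]; simp
  · intro a ha; simp [ha]

/-- A Post–Turing machine with finitely many symbols and effectively finitely many states can be
renamed so that its states and symbols are initial segments of the natural numbers. -/
theorem Turing.TM0.exists_fin_machine {Λ Γ : Type} [Inhabited Λ] [Inhabited Γ] [Finite Γ]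
    (M : TM0.Machine Γ Λ) {S : Set Λ} (hS : S.Finite) (ss : TM0.Supports M S) :
    ∃ (N G : ℕ) (T : TM0.Machine (Fin (G + 1)) (Fin (N + 1))) (e : Γ → Fin (G + 1)),
      ∀ l : List Γ, (StateTransition.eval (TM0.step T) (TM0.init (l.map e))).Dom ↔
        (TM0.eval M l).Dom := by
  obtain ⟨N, i, j, hi, -, hij⟩ := hS.exists_fin_numbering ss.1
  obtain ⟨G, e, e', he, he', hee⟩ := (Set.finite_univ (α := Γ)).exists_fin_numbering trivial
  let f₁ : PointedMap Γ (Fin (G + 1)) := ⟨e, he⟩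
  let f₂ : PointedMap (Fin (G + 1)) Γ := ⟨e', he'⟩
  let g₁ : PointedMap Λ (Fin (N + 1)) := ⟨i, hi⟩
  refine ⟨N, G, TM0.Machine.map M f₁ f₂ g₁ j, e, fun l => ?_⟩
  exact StateTransition.tr_eval_dom
    (TM0.Machine.map_respects M f₁ f₂ g₁ j ss (fun a => hee a trivial) hij)
    ⟨ss.1, TM0.map_init f₁ g₁ l⟩

/-- A Turing machine whose halting problem is undecidable already on tapes of the shape
`x y z z ⋯ z`. -/
theorem exists_fin_machine_not_computablePred :
    ∃ (N G : ℕ) (T : TM0.Machine (Fin (G + 1)) (Fin (N + 1))) (x y z : Fin (G + 1)),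
      ¬ ComputablePred fun m : ℕ =>
        (StateTransition.eval (TM0.step T) (TM0.init (x :: y :: List.replicate m z))).Dom := by
  classical
  obtain ⟨c, hc⟩ := exists_toPartrec_code_not_computablePred
  -- Machines start in the default label, so this instance selects the program `c`.
  let _ : Inhabited PartrecToTM2.Λ' := ⟨PartrecToTM2.trNormal c PartrecToTM2.Cont'.halt⟩
  let M₁ := TM2to1.tr PartrecToTM2.tr
  have ss := TM1to0.tr_supports M₁
    (TM2to1.tr_supports PartrecToTM2.tr (PartrecToTM2.tr_supports c PartrecToTM2.Cont'.halt))
  have : Finite PartrecToTM2.K' :=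
    Finite.of_surjective (![.main, .rev, .aux, .stack] : Fin 4 → PartrecToTM2.K') (by
      rintro (_ | _ | _ | _)
      exacts [⟨0, rfl⟩, ⟨1, rfl⟩, ⟨2, rfl⟩, ⟨3, rfl⟩])
  have : Finite (TM2to1.Γ' PartrecToTM2.K' fun _ => PartrecToTM2.Γ') :=
    inferInstanceAs (Finite (Bool × (PartrecToTM2.K' → Option PartrecToTM2.Γ')))
  obtain ⟨N, G, T, e, hT⟩ := TM0.exists_fin_machine (TM1to0.tr M₁) (Finset.finite_toSet _) ss
  -- A tape cell holds one entry of each stack, here only of the main one; the Boolean marks the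
  -- stack bottom.
  let cell (b : Bool) (a : PartrecToTM2.Γ') : TM2to1.Γ' PartrecToTM2.K' fun _ => PartrecToTM2.Γ' :=
    (b, Function.update (fun _ => none) PartrecToTM2.K'.main (some a))
  refine ⟨N, G, T, e (cell true .cons), e (cell false .bit1), e (cell false .bit0), fun h => hc ?_⟩
  refine h.of_eq fun m => ?_
  have hinit : TM2to1.trInit PartrecToTM2.K'.main (PartrecToTM2.trList [2 ^ m]) =
      cell true .cons :: cell false .bit1 :: List.replicate m (cell false .bit0) := by
    have hrev : (PartrecToTM2.trList [2 ^ m]).reverse =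
        .cons :: .bit1 :: List.replicate m .bit0 := by
      simp [PartrecToTM2.trList, PartrecToTM2.trNat_two_pow]
    rw [TM2to1.trInit, hrev]
    change cell true .cons :: cell false .bit1 ::
      List.map (cell false) (List.replicate m .bit0) = _
    rw [List.map_replicate]
  have := (hT (TM2to1.trInit PartrecToTM2.K'.main (PartrecToTM2.trList [2 ^ m]))).trans
    ((iff_of_eq (congrArg Part.Dom (TM1to0.tr_eval M₁ _))).trans
      (TM2to1.tr_eval_dom PartrecToTM2.tr _ _))
  rw [hinit] at this
  simp only [List.map_cons, List.map_replicate] at this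
  rw [this]
  have hi : TM2.init PartrecToTM2.K'.main (PartrecToTM2.trList [2 ^ m]) =
      PartrecToTM2.init c [2 ^ m] := by
    simp only [TM2.init, PartrecToTM2.init]
    congr 1
    funext k
    cases k <;> rfl
  change (StateTransition.eval _ _).Dom ↔ _
  rw [hi, PartrecToTM2.tr_eval]
  rfl

/-! ### Head moves and writing a tape from right to left -/

/-- The head move in a given direction. -/
def HeadMove.ofDir : Dir → HeadMove
  | Dir.left => HeadMove.L
  | Dir.right => HeadMove.R

theorem HeadMove.toNat_injective : Function.Injective HeadMove.toNat := by
  intro a b h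
  cases a <;> cases b <;> first | rfl | simp [HeadMove.toNat] at h

theorem HeadMove.onTape_ofDir {Γ : Type} [Inhabited Γ] (d : Dir) (t : Tape Γ) :
    (HeadMove.ofDir d).onTape t = t.move d := by
  cases d <;> rfl

theorem Turing.Tape.write_move_left_mk₁ {Γ : Type} [Inhabited Γ] (a : Γ) (l : List Γ) :
    (((Tape.mk₁ l).move Dir.left).write a) = Tape.mk₁ (a :: l) := by
  simp only [Tape.mk₁, Tape.mk₂, Tape.move_left_mk', Tape.write_mk']
  rfl

/-- The cell in front of the word is blank, so the transitions preparing the tape need only scan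
`0`. -/
theorem Turing.Tape.head_move_left_mk₁ {Γ : Type} [Inhabited Γ] (l : List Γ) :
    ((Tape.mk₁ l).move Dir.left).head = default := by
  simp only [Tape.mk₁, Tape.mk₂, Tape.move_left_mk']
  rfl

theorem Turing.Tape.move_left_mk₁_nil {Γ : Type} [Inhabited Γ] :
    (Tape.mk₁ ([] : List Γ)).move Dir.left = Tape.mk₁ [] := by
  simp only [Tape.mk₁, Tape.mk₂, Tape.move_left_mk']
  congr 1
  exact ListBlank.cons_head_tail (ListBlank.mk [])

theorem Relation.ReflTransGen.exists_seq {α : Type} {r : α → α → Prop} {a b : α}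
    (h : Relation.ReflTransGen r a b) :
    ∃ (n : ℕ) (f : ℕ → α), f 0 = a ∧ f n = b ∧ ∀ j < n, r (f j) (f (j + 1)) := by
  induction h using Relation.ReflTransGen.head_induction_on with
  | refl => exact ⟨0, fun _ => b, rfl, rfl, by simp⟩
  | @head a c hac _ ih =>
    obtain ⟨n, f, h0, hn, hf⟩ := ih
    refine ⟨n + 1, fun j => Nat.casesOn j a f, rfl, hn, fun j hj => ?_⟩
    cases j with
    | zero => simpa [h0] using hac
    | succ j => exact hf j (by omega)

/-! ### The machine built from `T` -/

namespace HaltingReduction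

/-- A transition in a machine description. -/
abbrev Row : Type := ℕ × Option (Option ℕ) × ℕ × ℕ × ℕ × ℕ

variable {N G : ℕ} (T : TM0.Machine (Fin (G + 1)) (Fin (N + 1))) (x y z : Fin (G + 1))
  (mv : HeadMove) (m : ℕ)

/-- What the simulation of `T` does in state `q` on the symbol `c`: the next state, the symbol
written and the head move. Where `T` halts, state `1` is entered. -/
def action (q : Fin (N + 1)) (c : Fin (G + 1)) : ℕ × Fin (G + 1) × HeadMove :=
  match T q c with
  | none => (1, c, HeadMove.S)
  | some (q', TM0.Stmt.write a) => (3 + q', a, HeadMove.S)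
  | some (q', TM0.Stmt.move d) => (3 + q', c, HeadMove.ofDir d)

/-- The transitions that do not depend on the tape length parameter: the simulation of `T`, an
optional oscillation of the head followed by acceptance, and the last two steps of the
preparation of the tape. -/
def fixedRows : List Row :=
  (List.finRange (N + 1)).flatMap (fun q : Fin (N + 1) =>
      (List.finRange (G + 1)).map fun c : Fin (G + 1) =>
      ((3 + q : ℕ), none, (c : ℕ), (action T q c).1, ((action T q c).2.1 : ℕ),
        (action T q c).2.2.toNat)) ++
    (List.finRange (G + 1)).map (fun c : Fin (G + 1) => (1, none, (c : ℕ), 2, (c : ℕ), 2)) ++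
    (List.finRange (G + 1)).map (fun c : Fin (G + 1) => (2, none, (c : ℕ), 1, (c : ℕ), 0)) ++
    (List.finRange (G + 1)).map (fun c : Fin (G + 1) => (1, some none, (c : ℕ), 0, (c : ℕ), 1)) ++
    [(N + 4, none, 0, 3, (x : ℕ), 1), (N + 5, none, 0, N + 4, (y : ℕ), 0)]

/-- All transitions: state `N + 5 + m` accepts at once with head move `mv`, or starts to write
`x y z ⋯ z` with `m` letters `z` from right to left. -/
def rows : List Row :=
  fixedRows T x y ++ (N + 5 + m, some none, 0, 0, 0, mv.toNat) ::
    (List.range m).map fun i => (N + 6 + i, none, 0, N + 5 + i, (z : ℕ), 0)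

/-- A machine that accepts only the empty word: either at once with head move `mv`, or by
simulating `T` on the tape `x y z ⋯ z` until it halts and then oscillating for a while. -/
def description : NTMDescription :=
  (N + 5 + m, 1, G, rows T x y z mv m, N + 5 + m, [0])

/-- The rows simulating `T` form a constant list; `m` only shifts state numbers and sets the length
of a range. -/
theorem computable_description : Computable fun m => description T x y z mv m := by
  have hadd : ∀ k : ℕ, Primrec fun m : ℕ => k + m := fun k =>
    Primrec.nat_add.comp (Primrec.const k) Primrec.id
  have hrows : Primrec fun m => rows T x y z mv m := by
    refine Primrec.list_append.comp (Primrec.const _) (Primrec.list_cons.comp ?_ ?_)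
    · exact (hadd _).pair (Primrec.const _)
    · refine Primrec.list_map Primrec.list_range ?_
      exact Primrec.to₂ (α := ℕ) (β := ℕ) <|
        ((hadd _).comp Primrec.snd).pair ((Primrec.const none).pair ((Primrec.const 0).pair
        (((hadd _).comp Primrec.snd).pair (Primrec.const _))))
  exact ((hadd _).pair ((Primrec.const 1).pair ((Primrec.const G).pair
    (hrows.pair ((hadd _).pair (Primrec.const [0])))))).to_comp

theorem mem_rows {r : Row} : r ∈ rows T x y z mv m ↔
    (∃ (q : Fin (N + 1)) (c : Fin (G + 1)),
      r = ((3 + q : ℕ), none, (c : ℕ), (action T q c).1, ((action T q c).2.1 : ℕ),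
      (action T q c).2.2.toNat)) ∨
    (∃ c : Fin (G + 1), r = (1, none, (c : ℕ), 2, (c : ℕ), 2)) ∨
    (∃ c : Fin (G + 1), r = (2, none, (c : ℕ), 1, (c : ℕ), 0)) ∨
    (∃ c : Fin (G + 1), r = (1, some none, (c : ℕ), 0, (c : ℕ), 1)) ∨
    r = (N + 4, none, 0, 3, (x : ℕ), 1) ∨
    r = (N + 5, none, 0, N + 4, (y : ℕ), 0) ∨
    r = (N + 5 + m, some none, 0, 0, 0, mv.toNat) ∨
    ∃ i < m, r = (N + 6 + i, none, 0, N + 5 + i, (z : ℕ), 0) := by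
  simp only [rows, fixedRows, List.mem_append, List.mem_flatMap, List.mem_map, List.mem_finRange,
    true_and, List.mem_cons, List.not_mem_nil, or_false, List.mem_range, eq_comm (a := r), or_assoc]

/-- The configurations of the described machine. -/
abbrev Config (N G m : ℕ) : Type := NTMConfig (Fin (N + 5 + m + 1)) (Fin 1) (Fin (G + 1))

/-- The described machine. -/
def machine : NTM (Fin (N + 5 + m + 1)) (Fin 1) (Fin (G + 1)) :=
  (description T x y z mv m).machine

theorem machine_start : ((machine T x y z mv m).start : ℕ) = N + 5 + m :=
  Nat.mod_eq_of_lt (Nat.lt_succ_self _)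

theorem mem_final {q : Fin (N + 5 + m + 1)} : q ∈ (machine T x y z mv m).final ↔ (q : ℕ) = 0 :=
  List.mem_singleton

variable {T x y z mv m}

theorem step_of_mem_rows {q q' : Fin (N + 5 + m + 1)} {a : InputLabel (Fin 1)}
    {d : Fin (G + 1)} {e : HeadMove} {t t' : Tape (Fin (G + 1))} {w : List (Option (Fin 1))}
    {i i' : ℤ}
    (h : ((q : ℕ), a.map (Option.map Fin.val), (t.head : ℕ), (q' : ℕ), (d : ℕ), e.toNat) ∈
      rows T x y z mv m) (ht : t' = e.onTape (t.write d)) (hi : i' = i + e.delta) :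
    (machine T x y z mv m).Step ⟨q, a.toList ++ w, t, i⟩ ⟨q', w, t', i'⟩ :=
  ⟨a, d, e, h, rfl, ht, hi⟩

theorem step_iff {c c' : Config N G m} : (machine T x y z mv m).Step c c' ↔
    ∃ (a : InputLabel (Fin 1)) (d : Fin (G + 1)) (e : HeadMove),
      ((c.state : ℕ), a.map (Option.map Fin.val), (c.tape.head : ℕ), (c'.state : ℕ), (d : ℕ),
        e.toNat) ∈ rows T x y z mv m ∧
      c.input = a.toList ++ c'.input ∧ c'.tape = e.onTape (c.tape.write d) ∧
      c'.addr = c.addr + e.delta :=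
  Iff.rfl

/-- A step of `T` either writes or moves, never both. A write is simulated with a stationary head, a
move by rewriting the scanned symbol. -/
theorem step_eq_of_action {q q' : Fin (N + 1)} {s : TM0.Stmt (Fin (G + 1))}
    {t : Tape (Fin (G + 1))} (h : T q t.head = some (q', s)) :
    (action T q t.head).1 = 3 + q' ∧ TM0.step T ⟨q, t⟩ = some
      ⟨q', (action T q t.head).2.2.onTape (t.write (action T q t.head).2.1)⟩ := by
  cases s
  · simp [action, h, TM0.step, HeadMove.onTape_ofDir, Tape.write_self]
  · simp [action, h, TM0.step, HeadMove.onTape]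

/-- The machine does not read letters, so that it accepts at most the empty word. -/
theorem eq_nil_of_mem_language {w : List (Fin 1)} (hw : w ∈ (machine T x y z mv m).language) :
    w = [] := by
  obtain ⟨n, c, h⟩ := hw
  cases w with
  | nil => rfl
  | cons b w =>
    -- A nonempty input is never consumed: the end-marker is hidden behind a letter that no row
    -- reads.
    have key : ∀ j ≤ n, (c j).input = (b :: w).map some ++ [none] := by
      intro j
      induction j with
      | zero => intro _; rw [h.init]; rfl
      | succ j ih =>
        intro hj
        obtain ⟨a, d, e, hrow, hin, -, -⟩ := step_iff.1 (h.step j (by omega))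
        rw [ih (by omega)] at hin
        rcases a with _ | _ | a
        · simpa using hin.symm
        · simp at hin
        · simp [mem_rows] at hrow
    have := key n le_rfl
    rw [h.input_eq] at this
    simp at this

end HaltingReduction

/-! ### Correctness of the reduction -/

namespace HaltingReduction

variable {N G : ℕ} {T : TM0.Machine (Fin (G + 1)) (Fin (N + 1))} {x y z : Fin (G + 1)}
  {mv : HeadMove} {m : ℕ}

/-- The initial configuration of `T` on the tape `x y z ⋯ z` with `m` letters `z`. -/
def simInit (N : ℕ) (x y z : Fin (G + 1)) (m : ℕ) : TM0.Cfg (Fin (G + 1)) (Fin (N + 1)) :=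
  TM0.init (x :: y :: List.replicate m z)

/-- What is true at time `t` in every computation of the machine, if `T` does not halt. -/
def Invariant (T : TM0.Machine (Fin (G + 1)) (Fin (N + 1))) (x y z : Fin (G + 1)) (mv : HeadMove)
    (m t : ℕ) (c : Config N G m) : Prop :=
  (t ≤ m ∧ (c.state : ℕ) = N + 5 + (m - t) ∧
    c.tape = (Tape.mk₁ (List.replicate t z)).move Dir.left ∧ c.addr = 1 - t) ∨
  ((c.state : ℕ) = N + 4 ∧ c.tape = (Tape.mk₁ (y :: List.replicate m z)).move Dir.left) ∨
  (∃ q : Fin (N + 1), (c.state : ℕ) = 3 + q ∧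
    StateTransition.Reaches (TM0.step T) (simInit N x y z m) ⟨q, c.tape⟩) ∨
  (t = 1 ∧ (c.state : ℕ) = 0 ∧ c.addr = 1 + mv.delta)

theorem invariant_initial (w : List (Fin 1)) :
    Invariant T x y z mv m 0 ((machine T x y z mv m).initial w) := by
  refine Or.inl ⟨m.zero_le, machine_start T x y z mv m, ?_, rfl⟩
  exact Tape.move_left_mk₁_nil.symm

/-- States `1` and `2` are missing from `Invariant` because the simulation enters `1` only where `T`
halts, contradicting `hT`. Immediate acceptance needs state `N + 5 + m`, hence `t = 0`, and no row
leaves state `0`. -/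
theorem Invariant.step (hT : ¬ (StateTransition.eval (TM0.step T) (simInit N x y z m)).Dom)
    {t : ℕ} {c c' : Config N G m} (h : Invariant T x y z mv m t c)
    (hs : (machine T x y z mv m).Step c c') : Invariant T x y z mv m (t + 1) c' := by
  obtain ⟨a, d, e, hrow, -, htape, haddr⟩ := step_iff.1 hs
  rw [mem_rows] at hrow
  simp only [Prod.mk.injEq] at hrow
  rcases h with ⟨ht, hq, hc, hi⟩ | ⟨hq, hc⟩ | ⟨q, hq, hr⟩ | ⟨-, hq, -⟩
  · rcases hrow with ⟨q', _, h, _⟩ | ⟨_, h, _⟩ | ⟨_, h, _⟩ | ⟨_, h, _⟩ | ⟨h, _⟩ |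
      ⟨h, -, -, hq', hd, he⟩ | ⟨h, -, -, hq', hd, he⟩ | ⟨i, him, h, -, -, hq', hd, he⟩
    · omega
    · omega
    · omega
    · omega
    · omega
    · obtain rfl : t = m := by omega
      obtain rfl : e = HeadMove.L := HeadMove.toNat_injective he
      obtain rfl : d = y := Fin.ext hd
      refine Or.inr (Or.inl ⟨hq', ?_⟩)
      rw [htape, hc, Tape.write_move_left_mk₁]
      rfl
    · obtain rfl : t = 0 := by omega
      obtain rfl : e = mv := HeadMove.toNat_injective he
      exact Or.inr (Or.inr (Or.inr ⟨rfl, hq', by simpa [hi] using haddr⟩))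
    · obtain rfl : e = HeadMove.L := HeadMove.toNat_injective he
      obtain rfl : d = z := Fin.ext hd
      refine Or.inl ⟨by omega, by omega, ?_, ?_⟩
      · rw [htape, hc, Tape.write_move_left_mk₁]
        rfl
      · rw [haddr, hi]
        simp only [HeadMove.delta]
        push_cast
        ring
  · rcases hrow with ⟨q', _, h, _⟩ | ⟨_, h, _⟩ | ⟨_, h, _⟩ | ⟨_, h, _⟩ | ⟨h, -, -, hq', hd, he⟩ |
      ⟨h, _⟩ | ⟨h, _⟩ | ⟨i, him, h, _⟩
    · omega
    · omega
    · omega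
    · omega
    · obtain rfl : e = HeadMove.S := HeadMove.toNat_injective he
      obtain rfl : d = x := Fin.ext hd
      refine Or.inr (Or.inr (Or.inl ⟨0, hq', ?_⟩))
      rw [htape, hc, Tape.write_move_left_mk₁]
      exact Relation.ReflTransGen.refl
    · omega
    · omega
    · omega
  · rcases hrow with ⟨q', b, h, -, hb, hq', hd, he⟩ | ⟨_, h, _⟩ | ⟨_, h, _⟩ | ⟨_, h, _⟩ | ⟨h, _⟩ |
      ⟨h, _⟩ | ⟨h, _⟩ | ⟨i, him, h, _⟩
    · obtain rfl : q = q' := Fin.ext (by omega)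
      obtain rfl : c.tape.head = b := Fin.ext hb
      obtain rfl : e = _ := HeadMove.toNat_injective he
      obtain rfl : d = _ := Fin.ext hd
      cases hact : T q c.tape.head with
      | none =>
        exact absurd (Part.dom_iff_mem.2 ⟨_, StateTransition.mem_eval.2
          ⟨hr, by simp [TM0.step, hact]⟩⟩) hT
      | some p =>
        obtain ⟨hp, hstep⟩ := step_eq_of_action hact
        refine Or.inr (Or.inr (Or.inl ⟨p.1, hq'.trans hp, hr.tail ?_⟩))
        rw [htape]
        exact hstep
    all_goals omega
  · rcases hrow with ⟨q', _, h, _⟩ | ⟨_, h, _⟩ | ⟨_, h, _⟩ | ⟨_, h, _⟩ | ⟨h, _⟩ | ⟨h, _⟩ | ⟨h, _⟩ |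
      ⟨i, him, h, _⟩
    all_goals omega

/-- If `T` does not halt, then every accepting computation consists of a single step. -/
theorem accepting_of_not_halts
    (hT : ¬ (StateTransition.eval (TM0.step T) (simInit N x y z m)).Dom) {w : List (Fin 1)} {n : ℕ}
    {c : ℕ → Config N G m} (h : (machine T x y z mv m).IsAcceptingComputation w n c) :
    n = 1 ∧ (c 0).addr = 1 ∧ (c 1).addr = 1 + mv.delta := by
  have key : ∀ j ≤ n, Invariant T x y z mv m j (c j) := by
    intro j
    induction j with
    | zero => intro _; rw [h.init]; exact invariant_initial w
    | succ j ih => exact fun hj => (ih (by omega)).step hT (h.step j (by omega))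
  have hq := (mem_final T x y z mv m).1 h.state_mem
  rcases key n le_rfl with ⟨_, h', _⟩ | ⟨h', _⟩ | ⟨q, h', _⟩ | ⟨rfl, _, h'⟩
  · omega
  · omega
  · omega
  · exact ⟨rfl, by rw [h.init]; rfl, h'⟩

/-- The empty word is accepted in one step. -/
theorem nil_mem_language : [] ∈ (machine T x y z mv m).language := by
  let c₀ : Config N G m := (machine T x y z mv m).initial []
  let c₁ : Config N G m := ⟨0, [], mv.onTape (c₀.tape.write 0), 1 + mv.delta⟩
  refine ⟨1, fun j => Nat.casesOn j c₀ fun _ => c₁, rfl, ?_, ?_, rfl⟩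
  · intro j hj
    obtain rfl : j = 0 := by omega
    refine step_iff.2 ⟨some none, 0, mv, ?_, rfl, rfl, rfl⟩
    rw [mem_rows]
    refine Or.inr (Or.inr (Or.inr (Or.inr (Or.inr (Or.inr (Or.inl (Prod.ext ?_ rfl)))))))
    exact machine_start T x y z mv m
  · exact (mem_final T x y z mv m).2 rfl

/-- If `T` halts, the machine can enter the oscillation. -/
theorem exists_reaches_of_halts
    (hT : (StateTransition.eval (TM0.step T) (simInit N x y z m)).Dom) :
    ∃ (t : Tape (Fin (G + 1))) (i : ℤ), Relation.ReflTransGen (machine T x y z mv m).Step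
      ((machine T x y z mv m).initial []) ⟨⟨1, by omega⟩, [none], t, i⟩ := by
  have hpre : ∀ j (hj : j ≤ m), ∃ i : ℤ, Relation.ReflTransGen (machine T x y z mv m).Step
      ((machine T x y z mv m).initial [])
      ⟨⟨N + 5 + (m - j), by omega⟩, [none], (Tape.mk₁ (List.replicate j z)).move Dir.left, i⟩ := by
    intro j
    induction j with
    | zero =>
      refine fun _ => ⟨1, ?_⟩
      have : (machine T x y z mv m).initial [] =
          ⟨⟨N + 5 + (m - 0), by omega⟩, [none], (Tape.mk₁ (List.replicate 0 z)).move Dir.left, 1⟩ := by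
        have := machine_start T x y z mv m
        simp only [NTM.initial, List.replicate_zero, Tape.move_left_mk₁_nil]
        congr 1
        exact Fin.ext this
      rw [this]
    | succ j ih =>
      intro hj
      obtain ⟨i, hi⟩ := ih (by omega)
      refine ⟨i + HeadMove.L.delta, hi.tail ?_⟩
      refine step_of_mem_rows (a := none) (d := z) (e := HeadMove.L) ?_ ?_ rfl
      · rw [mem_rows, Tape.head_move_left_mk₁]
        refine Or.inr (Or.inr (Or.inr (Or.inr (Or.inr (Or.inr (Or.inr ⟨m - (j + 1), by omega, ?_⟩))))))
        rw [show N + 6 + (m - (j + 1)) = N + 5 + (m - j) by omega]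
        rfl
      · rw [Tape.write_move_left_mk₁]; rfl
  obtain ⟨i, hi⟩ := hpre m le_rfl
  have hY : ∃ i : ℤ, Relation.ReflTransGen (machine T x y z mv m).Step
      ((machine T x y z mv m).initial [])
      ⟨⟨N + 4, by omega⟩, [none], (Tape.mk₁ (y :: List.replicate m z)).move Dir.left, i⟩ := by
    refine ⟨i + HeadMove.L.delta, hi.tail ?_⟩
    refine step_of_mem_rows (a := none) (d := y) (e := HeadMove.L) ?_ ?_ rfl
    · rw [mem_rows, Tape.head_move_left_mk₁]
      refine Or.inr (Or.inr (Or.inr (Or.inr (Or.inr (Or.inl ?_)))))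
      exact Prod.ext (by simp) rfl
    · rw [Tape.write_move_left_mk₁]; rfl
  obtain ⟨i, hi⟩ := hY
  have hsim : ∀ s : TM0.Cfg (Fin (G + 1)) (Fin (N + 1)),
      StateTransition.Reaches (TM0.step T) (simInit N x y z m) s → ∃ i : ℤ,
      Relation.ReflTransGen (machine T x y z mv m).Step ((machine T x y z mv m).initial [])
      ⟨⟨3 + s.q, by omega⟩, [none], s.Tape, i⟩ := by
    intro s hs
    induction hs with
    -- The base case is the step that writes `x`; it leads to state `3`, which simulates the start
    -- state `0` of `T`.
    | refl =>
      refine ⟨i + HeadMove.S.delta, hi.tail ?_⟩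
      refine step_of_mem_rows (a := none) (d := x) (e := HeadMove.S) ?_ ?_ rfl
      · rw [mem_rows, Tape.head_move_left_mk₁]
        exact Or.inr (Or.inr (Or.inr (Or.inr (Or.inl rfl))))
      · rw [Tape.write_move_left_mk₁]; rfl
    | @tail s s' _ hstep ih =>
      obtain ⟨i, hi⟩ := ih
      cases hact : T s.q s.Tape.head with
      | none => simp [TM0.step, hact] at hstep
      | some p =>
        obtain ⟨hp, hstep'⟩ := step_eq_of_action hact
        obtain rfl := Option.some.inj (hstep'.symm.trans hstep)
        refine ⟨_, hi.tail (step_of_mem_rows (a := none) ?_ rfl rfl)⟩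
        rw [mem_rows]
        exact Or.inl ⟨s.q, s.Tape.head, by rw [hp]; rfl⟩
  obtain ⟨s, hs⟩ := Part.dom_iff_mem.1 hT
  obtain ⟨hs, hhalt⟩ := StateTransition.mem_eval.1 hs
  obtain ⟨i, hi⟩ := hsim s hs
  have hact : T s.q s.Tape.head = none := by simpa [TM0.step] using hhalt
  refine ⟨s.Tape, i + HeadMove.S.delta, hi.tail ?_⟩
  refine step_of_mem_rows (a := none) (d := s.Tape.head) (e := HeadMove.S) ?_ ?_ rfl
  · rw [mem_rows]
    exact Or.inl ⟨s.q, s.Tape.head, by simp [action, hact]⟩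
  · rw [Tape.write_self]; rfl

/-- If `T` halts, there are accepting computations with arbitrarily long oscillations. -/
theorem exists_accepting_of_halts
    (hT : (StateTransition.eval (TM0.step T) (simInit N x y z m)).Dom) (K : ℕ) :
    ∃ (n₀ : ℕ) (c : ℕ → Config N G m) (i : ℤ),
      (machine T x y z mv m).IsAcceptingComputation [] (n₀ + 2 * K + 1) c ∧
      ∀ j ≤ 2 * K, (c (n₀ + j)).addr = i + (j % 2 : ℕ) := by
  obtain ⟨t, i, h⟩ := exists_reaches_of_halts (mv := mv) hT
  obtain ⟨n₀, f, h0, hn, hf⟩ := h.exists_seq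
  -- Swinging rewrites every scanned symbol unchanged, so two configurations alternate forever.
  let u : ℕ → Config N G m := fun j => if j % 2 = 0 then ⟨⟨1, by omega⟩, [none], t, i⟩
    else ⟨⟨2, by omega⟩, [none], t.move Dir.right, i + 1⟩
  have hu : ∀ j, (machine T x y z mv m).Step (u j) (u (j + 1)) := by
    intro j
    rcases Nat.mod_two_eq_zero_or_one j with hj | hj
    · have h1 : u j = ⟨⟨1, by omega⟩, [none], t, i⟩ := by simp [u, hj]
      have h2 : u (j + 1) = ⟨⟨2, by omega⟩, [none], t.move Dir.right, i + 1⟩ := by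
        simp [u, show (j + 1) % 2 = 1 by omega]
      rw [h1, h2]
      refine step_of_mem_rows (a := none) (d := t.head) (e := HeadMove.R) ?_ ?_ rfl
      · rw [mem_rows]
        exact Or.inr (Or.inl ⟨t.head, rfl⟩)
      · rw [Tape.write_self]; rfl
    · have h1 : u j = ⟨⟨2, by omega⟩, [none], t.move Dir.right, i + 1⟩ := by simp [u, hj]
      have h2 : u (j + 1) = ⟨⟨1, by omega⟩, [none], t, i⟩ := by
        simp [u, show (j + 1) % 2 = 0 by omega]
      rw [h1, h2]
      refine step_of_mem_rows (a := none) (d := (t.move Dir.right).head) (e := HeadMove.L) ?_ ?_ ?_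
      · rw [mem_rows]
        exact Or.inr (Or.inr (Or.inl ⟨_, rfl⟩))
      · rw [Tape.write_self]; exact (Tape.move_right_left t).symm
      · simp [HeadMove.delta]
  have hu0 : ∀ j, u (2 * j) = ⟨⟨1, by omega⟩, [none], t, i⟩ := fun j => by simp [u]
  let c : ℕ → Config N G m := fun j =>
    if j < n₀ then f j else if j ≤ n₀ + 2 * K then u (j - n₀) else ⟨⟨0, by omega⟩, [], t, i⟩
  have hc : ∀ j ≤ 2 * K, c (n₀ + j) = u j := fun j hj => by simp [c, hj]
  have hlast : c (n₀ + 2 * K + 1) = ⟨⟨0, by omega⟩, [], t, i⟩ := by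
    simp only [c]
    rw [if_neg (by omega), if_neg (by omega)]
  have hcf : ∀ j ≤ n₀, c j = f j := by
    intro j hj
    rcases hj.lt_or_eq with hj | rfl
    · simp [c, hj]
    · rw [hn, ← hu0 0]
      exact hc 0 (Nat.zero_le _)
  refine ⟨n₀, c, i, ⟨?_, ?_, ?_, ?_⟩, ?_⟩
  · rw [hcf 0 (Nat.zero_le _), h0]
  · intro j hj
    rcases lt_or_ge j n₀ with hj' | hj'
    · rw [hcf j hj'.le, hcf (j + 1) hj']
      exact hf j hj'
    obtain ⟨l, rfl⟩ := Nat.exists_eq_add_of_le hj'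
    rcases lt_or_ge l (2 * K) with hl | hl
    · rw [hc l hl.le, show c (n₀ + l + 1) = u (l + 1) from hc (l + 1) hl]
      exact hu l
    -- As `2 * K` is even, the swing ends in state `1`, from which the end-marker can be consumed.
    · obtain rfl : l = 2 * K := by omega
      rw [hlast, hc _ le_rfl, hu0]
      refine step_of_mem_rows (a := some none) (d := t.head) (e := HeadMove.S) (w := []) ?_ ?_ ?_
      · rw [mem_rows]
        exact Or.inr (Or.inr (Or.inr (Or.inl ⟨_, rfl⟩)))
      · rw [Tape.write_self]; rfl
      · simp [HeadMove.delta]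
  · rw [hlast]; exact (mem_final T x y z mv m).2 rfl
  · rw [hlast]
  · intro j hj
    rw [hc j hj]
    rcases Nat.mod_two_eq_zero_or_one j with hj | hj <;> simp [u, hj]

end HaltingReduction

/-! ### The undecidability criterion and the three bounds -/

open HaltingReduction in
/-- A property of address sequences that holds after one suitable step and excludes long
oscillations of the head is undecidable, in the sense of `NTM.ExistsInputAllAccepting`. -/
theorem not_computablePred_existsInputAllAccepting (P : ℕ → (ℕ → ℤ) → Prop) (mv : HeadMove) (K : ℕ)
    (hP : ∀ i : ℕ → ℤ, i 0 = 1 → i 1 = 1 + mv.delta → P 1 i)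
    (hP' : ∀ (n₀ : ℕ) (i : ℕ → ℤ) (r : ℤ), (∀ j ≤ 2 * K, i (n₀ + j) = r + (j % 2 : ℕ)) →
      ¬ P (n₀ + 2 * K + 1) i) :
    ¬ ComputablePred fun D : NTMDescription => D.machine.ExistsInputAllAccepting P := by
  obtain ⟨N, G, T, x, y, z, h⟩ := exists_fin_machine_not_computablePred
  refine fun hD => h ?_
  have key : ∀ m, (description T x y z mv m).machine.ExistsInputAllAccepting P ↔
      ¬ (StateTransition.eval (TM0.step T) (simInit N x y z m)).Dom := by
    intro m
    change (machine T x y z mv m).ExistsInputAllAccepting P ↔ _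
    constructor
    · rintro ⟨w, hw, hall⟩ hT
      obtain rfl := eq_nil_of_mem_language hw
      obtain ⟨n₀, c, r, hacc, hr⟩ := exists_accepting_of_halts (mv := mv) hT K
      exact hP' n₀ _ r hr (hall _ c hacc)
    · intro hT
      refine ⟨[], nil_mem_language, fun n c hacc => ?_⟩
      obtain ⟨rfl, h0, h1⟩ := accepting_of_not_halts hT hacc
      exact hP _ h0 h1
  have hcomp : ComputablePred fun m =>
      ¬ (StateTransition.eval (TM0.step T) (simInit N x y z m)).Dom :=
    ComputablePred.computable_of_manyOneReducible
      ⟨fun m => description T x y z mv m, computable_description T x y z mv,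
        fun m => (key m).symm⟩ hD
  exact hcomp.not.of_eq fun m => not_not

/-- Each oscillation step after the first reverses the previous one. Step `n₀ + (l + 2)` is a turn
witnessed by time `n₀ + l`, and `l ≤ k` gives `k + 1` turns. -/
theorem not_isKTurn_of_oscillation (k n₀ : ℕ) (i : ℕ → ℤ) (r : ℤ)
    (h : ∀ j ≤ 2 * (k + 1), i (n₀ + j) = r + (j % 2 : ℕ)) :
    ¬ IsKTurn k (n₀ + 2 * (k + 1) + 1) i := by
  intro hk
  have hsub : (fun l => n₀ + (l + 2)) '' Set.Iio (k + 1) ⊆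
      {j | j ≤ n₀ + 2 * (k + 1) + 1 ∧ MakesTurn i j} := by
    rintro _ ⟨l, hl, rfl⟩
    have hl : l < k + 1 := hl
    have h0 := h l (by omega)
    have h1 := h (l + 1) (by omega)
    have h2 := h (l + 2) (by omega)
    refine ⟨by simp only; omega, by simp only; omega, n₀ + l, ⟨⟨by simp only; omega, ?_⟩, ?_⟩, ?_⟩
    · change i (n₀ + l) ≠ i (n₀ + (l + 1))
      omega
    · rintro j ⟨hj, hne⟩
      by_contra hlt
      have hj : j ≤ n₀ + (l + 1) := hj
      obtain rfl : j = n₀ + (l + 1) := by omega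
      exact hne rfl
    · change (i (n₀ + (l + 2)) < i (n₀ + (l + 1)) ∧ i (n₀ + l) < i (n₀ + (l + 1))) ∨
        (i (n₀ + (l + 1)) < i (n₀ + (l + 2)) ∧ i (n₀ + (l + 1)) < i (n₀ + l))
      omega
  have hcard := Set.ncard_le_ncard hsub ((Set.finite_Iic _).subset fun j hj => hj.1)
  rw [Set.ncard_image_of_injective _ fun a b hab => by simpa using hab] at hcard
  have : (Set.Iio (k + 1)).ncard = k + 1 := by simp [← Finset.coe_range]
  unfold IsKTurn at hk
  omega

/-- Every oscillation step crosses the boundary between `r` and `r + 1`. -/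
theorem not_isKCrossing_of_oscillation (k n₀ : ℕ) (i : ℕ → ℤ) (r : ℤ)
    (h : ∀ j ≤ 2 * (k + 1), i (n₀ + j) = r + (j % 2 : ℕ)) :
    ¬ IsKCrossing k (n₀ + 2 * (k + 1) + 1) i := by
  intro hk
  have hk := hk r
  have hsub : (fun l => n₀ + l) '' Set.Iio (k + 1) ⊆
      {j | j < n₀ + 2 * (k + 1) + 1 ∧ ((i j = r ∧ i (j + 1) = r + 1) ∨
        (i j = r + 1 ∧ i (j + 1) = r))} := by
    rintro _ ⟨l, hl, rfl⟩
    have hl : l < k + 1 := hl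
    have h0 := h l (by omega)
    have h1 := h (l + 1) (by omega)
    rw [← add_assoc] at h1
    refine ⟨by simp only; omega, ?_⟩
    simp only
    omega
  have hcard := Set.ncard_le_ncard hsub ((Set.finite_Iio _).subset fun j hj => hj.1)
  rw [Set.ncard_image_of_injective _ fun a b hab => by simpa using hab] at hcard
  have : (Set.Iio (k + 1)).ncard = k + 1 := by simp [← Finset.coe_range]
  omega

/-- The head is at `r` after each even number of oscillation steps. -/
theorem not_isKVisit_of_oscillation (k n₀ : ℕ) (i : ℕ → ℤ) (r : ℤ)
    (h : ∀ j ≤ 2 * (k + 1), i (n₀ + j) = r + (j % 2 : ℕ)) :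
    ¬ IsKVisit k (n₀ + 2 * (k + 1) + 1) i := by
  intro hk
  have hk := hk r
  have hsub : (fun l => n₀ + 2 * l) '' Set.Iio (k + 1) ⊆
      {j | j ≤ n₀ + 2 * (k + 1) + 1 ∧ i j = r} := by
    rintro _ ⟨l, hl, rfl⟩
    have hl : l < k + 1 := hl
    have h0 := h (2 * l) (by omega)
    refine ⟨by simp only; omega, ?_⟩
    simp only
    omega
  have hcard := Set.ncard_le_ncard hsub ((Set.finite_Iic _).subset fun j hj => hj.1)
  rw [Set.ncard_image_of_injective _ fun a b hab => by simpa using hab] at hcard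
  have : (Set.Iio (k + 1)).ncard = k + 1 := by simp [← Finset.coe_range]
  omega

/-- A turn needs an earlier move, and none precedes the first step. -/
theorem isKTurn_one_step (k : ℕ) (i : ℕ → ℤ) : IsKTurn k 1 i := by
  have : {j | j ≤ 1 ∧ MakesTurn i j} = ∅ := by
    ext j
    simp only [Set.mem_ofPred_eq, Set.mem_empty_iff_false, iff_false]
    rintro ⟨hj, hj', l, ⟨⟨hl, hne⟩, -⟩, -⟩
    obtain rfl : j = 1 := by omega
    obtain rfl : l = 0 := by omega
    exact hne rfl
  simp [IsKTurn, this]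

/-- For `k = 0` the accepting step may cross nothing, which dictates the move `S`. -/
theorem isKCrossing_of_stay (k : ℕ) (i : ℕ → ℤ) (h : i 1 = i 0) : IsKCrossing k 1 i := by
  intro r
  have : {j | j < 1 ∧ ((i j = r ∧ i (j + 1) = r + 1) ∨ (i j = r + 1 ∧ i (j + 1) = r))} = ∅ := by
    ext j
    simp only [Set.mem_ofPred_eq, Set.mem_empty_iff_false, iff_false]
    rintro ⟨hj, h'⟩
    obtain rfl : j = 0 := by omega
    simp only [zero_add] at h'
    omega
  rw [this]
  simp

/-- For `k = 1` staying would visit the initial cell twice, so here the accepting step must move. -/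
theorem isKVisit_of_move {k : ℕ} (hk : 1 ≤ k) (i : ℕ → ℤ) (h : i 1 ≠ i 0) : IsKVisit k 1 i := by
  intro r
  refine le_trans ((Set.ncard_le_one_iff ((Set.finite_Iic 1).subset fun j hj => hj.1)).2 ?_) hk
  rintro a b ⟨ha, ha'⟩ ⟨hb, hb'⟩
  interval_cases a <;> interval_cases b <;> first | rfl | omega

theorem mainTheorem6 :
    -- undecidable, given a machine and `k`
    (¬ ComputablePred fun p : NTMDescription × ℕ =>
      p.1.machine.ExistsInputAllAccepting (IsKTurn p.2)) ∧
    (¬ ComputablePred fun p : NTMDescription × ℕ =>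
      p.1.machine.ExistsInputAllAccepting (IsKCrossing p.2)) ∧
    (¬ ComputablePred fun p : NTMDescription × ℕ =>
      p.1.machine.ExistsInputAllAccepting (IsKVisit (p.2 + 1))) ∧
    -- undecidable for every fixed `k`, given a machine
    (∀ k : ℕ, ¬ ComputablePred fun D : NTMDescription =>
      D.machine.ExistsInputAllAccepting (IsKTurn k)) ∧
    (∀ k : ℕ, ¬ ComputablePred fun D : NTMDescription =>
      D.machine.ExistsInputAllAccepting (IsKCrossing k)) ∧
    (∀ k : ℕ, 1 ≤ k → ¬ ComputablePred fun D : NTMDescription =>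
      D.machine.ExistsInputAllAccepting (IsKVisit k)) := by
  have hturn : ∀ k : ℕ, ¬ ComputablePred fun D : NTMDescription =>
      D.machine.ExistsInputAllAccepting (IsKTurn k) := fun k =>
    not_computablePred_existsInputAllAccepting _ HeadMove.S (k + 1)
      (fun i _ _ => isKTurn_one_step k i) (not_isKTurn_of_oscillation k)
  have hcross : ∀ k : ℕ, ¬ ComputablePred fun D : NTMDescription =>
      D.machine.ExistsInputAllAccepting (IsKCrossing k) := fun k =>
    not_computablePred_existsInputAllAccepting _ HeadMove.S (k + 1)
      (fun i h0 h1 => isKCrossing_of_stay k i (by simp [h0, h1, HeadMove.delta]))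
      (not_isKCrossing_of_oscillation k)
  have hvisit : ∀ k : ℕ, 1 ≤ k → ¬ ComputablePred fun D : NTMDescription =>
      D.machine.ExistsInputAllAccepting (IsKVisit k) := fun k hk =>
    not_computablePred_existsInputAllAccepting _ HeadMove.R (k + 1)
      (fun i h0 h1 => isKVisit_of_move hk i (by simp [h0, h1, HeadMove.delta]))
      (not_isKVisit_of_oscillation k)
  -- Fixing the second component at `0` reduces to a fixed bound: `0` for turns and crossings, `1`
  -- for visits because of the shift `p.2 + 1`.
  have hpair : Computable fun D : NTMDescription => (D, 0) :=
    Computable.id.pair (Computable.const 0)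
  refine ⟨fun h => hturn 0 ?_, fun h => hcross 0 ?_, fun h => hvisit 1 le_rfl ?_,
    hturn, hcross, hvisit⟩
  all_goals exact ComputablePred.computable_of_manyOneReducible ⟨_, hpair, fun _ => Iff.rfl⟩ h
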